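/- Let $\lambda$ be Lebesgue measure on $[0,1]$ and let $f:[0,1]\to[0,1]$ be measure-preserving, i.e. $f$ is measurable and $\lambda(f^{-1}(B))=\lambda(B)$ for every Borel set $B\subseteq[0,1]$. Suppose that $f$ is piecewise continuously differentiable with finitely many pieces: there are points $0=a_0<a_1<\dots<a_N=1$ such that $f$ is continuously differentiable on each open interval $(a_{k},a_{k+1})$, $0\le k<N$ (the derivative may be unbounded near the points $a_k$, and the values $f(a_k)$ are arbitrary). Let $\mu_f$ be the graph permuton of $f$, i.e. the probability measure on $[0,1]^2$ with uniform marginals given by $\mu_f(A\times B)=\lambda(A\cap f^{-1}(B))$ for Borel $A,B\subseteq[0,1]$. For $n\ge 1$ let $\pi_n$ be the random permutation obtained by drawing $n$ independent points with law $\mu_f$ and reading their height ordering from left to right (that is, $\pi_n(i)$ is the rank of the height of the $i$-th point from the left; almost surely there are no ties), and let $$H_n(\mu_f)=-\sum_{\sigma\in\mathrm{Sym}(n)}\mathbb P(\pi_n=\sigma)\log\mathbb P(\pi_n=\sigma)$$ be its Shannon entropy (natural logarithm, $0\log 0=0$). Then $\log|f'|$, which is defined on $[0,1]$ outside a finite set,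 is Lebesgue integrable, and $$\lim_{n\to\infty}\frac{H_n(\mu_f)}{n}=\int_0^1\log|f'(x)|\,dx .$$ -/

import Mathlib

open MeasureTheory Set Filter Topology

noncomputable section

/-- A permuton: a (probability) measure on the unit square with uniform marginals. -/
structure Permuton where
  /-- The underlying measure on the unit square. -/
  toMeasure : Measure (unitInterval × unitInterval)
  map_fst : toMeasure.map Prod.fst = volume
  map_snd : toMeasure.map Prod.snd = volume

/-- The pattern `σ ∈ Sym(n)` is seen on the points `p 0, …, p (n - 1)` of the unit square: the
abscissae are distinct, `τ` lists the points from left to right, and the height of the `i`-th point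
from the left has rank `σ i` among all the (distinct) heights. -/
def patternSet {n : ℕ} (σ : Equiv.Perm (Fin n)) : Set (Fin n → unitInterval × unitInterval) :=
  {p | ∃ τ : Equiv.Perm (Fin n), StrictMono (fun i => (p (τ i)).1) ∧
    ∀ i j, (p (τ i)).2 < (p (τ j)).2 ↔ σ i < σ j}

namespace Permuton

/-- The pattern density `t(σ, μ)`: the probability that `n` independent points with law `μ`
determine the pattern `σ`. -/
def density (μ : Permuton) {n : ℕ} (σ : Equiv.Perm (Fin n)) : ℝ :=
  (Measure.pi fun _ : Fin n => μ.toMeasure).real (patternSet σ)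

/-- The sampling entropy `H_n(μ)`: the Shannon entropy of the random permutation determined by
`n` independent points with law `μ`. -/
def samplingEntropy (μ : Permuton) (n : ℕ) : ℝ :=
  ∑ σ : Equiv.Perm (Fin n), Real.negMulLog (μ.density σ)

/-- The graph permuton `μ_f` of a measure-preserving map `f : [0,1] → [0,1]`. -/
def ofMap (f : unitInterval → unitInterval) (hf : MeasurePreserving f volume volume) : Permuton where
  toMeasure := (volume : Measure unitInterval).map fun x => (x, f x)
  map_fst := by
    have hm : Measurable fun x => (x, f x) := measurable_id.prodMk hf.measurable
    rw [Measure.map_map measurable_fst hm]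
    exact Measure.map_id
  map_snd := by
    have hm : Measurable fun x => (x, f x) := measurable_id.prodMk hf.measurable
    rw [Measure.map_map measurable_snd hm]
    exact hf.map_eq

/-- The formula `μ_f(A × B) = λ(A ∩ f⁻¹(B))`, which determines `μ_f`. -/
theorem ofMap_prod (f : unitInterval → unitInterval) (hf : MeasurePreserving f volume volume) {A B : Set unitInterval}
    (hA : MeasurableSet A) (hB : MeasurableSet B) :
    (ofMap f hf).toMeasure (A ×ˢ B) = volume (A ∩ f ⁻¹' B) :=
  Measure.map_apply (measurable_id.prodMk hf.measurable) (hA.prod hB)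

end Permuton

/-- A map `f : [0,1] → [0,1]` as a real function; it is extended by constants to the left of `0`
and to the right of `1`, and only its behaviour on `(0,1)` is used. -/
def toRealFun (f : unitInterval → unitInterval) : ℝ → ℝ :=
  IccExtend zero_le_one fun x : unitInterval => (f x : ℝ)

/-- `f` is piecewise continuously differentiable with finitely many pieces: there is a partition
`0 = a 0 < a 1 < ⋯ < a N = 1` such that `f` is continuously differentiable on every open interval
`(a k, a (k+1))`. The derivative may be unbounded near the end points of the pieces, and `f` may
take any values at the partition points. -/
def IsPiecewiseC1 (f : unitInterval → unitInterval) : Prop :=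
  ∃ (N : ℕ) (a : Fin (N + 1) → ℝ), StrictMono a ∧ a 0 = 0 ∧ a (Fin.last N) = 1 ∧
    ∀ k : Fin N, ContDiffOn ℝ 1 (toRealFun f) (Ioo (a k.castSucc) (a k.succ))

end

/-! Since `f` preserves Lebesgue measure, the heights are again independent and uniform, and no C¹
piece can contract: `1 ≤ |f'|`. So every piece is a strictly monotone branch, and a point with given
height lies on the branch through `x` with probability `1 / |f' x|`. With the points listed by
increasing height, the word of branches determines the pattern. Conversely, heights and pattern
together leave at most `(n + 1) ^ N` branch words, because branch indices are monotone from left to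
right. Hence `H_n` should be `n` times the conditional entropy of the branch given the height,
namely `n ∫ log |f'|`, up to `o(n)`.

Lower bound (`le_samplingEntropy`): by change of variables the integral of `∏ |f' (x i)|` over one
pattern event is at most `(n + 1) ^ N` (`lintegral_patternEvent_le`), and Jensen's inequality turns
this into an entropy bound.

Upper bound (`samplingEntropy_le`): the pattern does not reveal the heights, so branches are coded
by weights that depend only on a grid cell of the height. Sorted cells form a monotone word; with
`m` cells there are at most `(n + 1) ^ m` of them, which costs `O(log n)` in Gibbs' inequality.
Under grid refinement the cell densities are asymptotically at least `1 / |f'|`, so the mean code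
length comes within any `ε` of `∫ log |f'|` (`exists_weights`). -/

/-! ### Counting monotone words; sorting permutations -/

section Combinatorics

open Classical in
/-- There are at most `(n + 1) ^ m` monotone maps from `Fin n` to `Fin m`. -/
theorem card_monotone_fin_le (n m : ℕ) :
    (Finset.univ.filter fun b : Fin n → Fin m => Monotone b).card ≤ (n + 1) ^ m := by
  -- A monotone map is encoded by the sizes of its sublevel sets, each between `0` and `n`.
  let count : (Fin n → Fin m) → (Fin m → Fin (n + 1)) := fun b k =>
    ⟨(Finset.univ.filter fun i => b i ≤ k).card,
      Nat.lt_succ_of_le ((Finset.card_le_univ _).trans (by simp))⟩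
  have hinj : Set.InjOn count (Finset.univ.filter fun b : Fin n → Fin m => Monotone b) := by
    intro b hb b' hb' h
    simp only [Finset.coe_filter, Finset.mem_univ, true_and, mem_ofPred_eq] at hb hb'
    have key : ∀ k, ∀ i, b i ≤ k ↔ b' i ≤ k := by
      intro k
      have hc : (Finset.univ.filter fun i => b i ≤ k).card =
          (Finset.univ.filter fun i => b' i ≤ k).card := by
        simpa [count] using congrFun h k
      have hl : IsLowerSet {i | b i ≤ k} := fun i j hij hi => (hb hij).trans hi
      have hl' : IsLowerSet {i | b' i ≤ k} := fun i j hij hi => (hb' hij).trans hi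
      have heq : (Finset.univ.filter fun i => b i ≤ k) = Finset.univ.filter fun i => b' i ≤ k := by
        -- Lower sets of a linear order are nested, so equal cardinality forces equality.
        rcases hl.total hl' with hs | hs
        · exact Finset.eq_of_subset_of_card_le
            (fun i hi => by simpa using hs (by simpa using hi)) hc.ge
        · exact (Finset.eq_of_subset_of_card_le
            (fun i hi => by simpa using hs (by simpa using hi)) hc.le).symm
      intro i
      have := Finset.ext_iff.1 heq i
      simpa using this
    funext i
    exact le_antisymm ((key (b' i) i).2 le_rfl) ((key (b i) i).1 le_rfl)
  calc _ ≤ (Finset.univ : Finset (Fin m → Fin (n + 1))).card :=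
        Finset.card_le_card_of_injOn count (fun _ _ => Finset.mem_coe.2 (Finset.mem_univ _)) hinj
    _ = (n + 1) ^ m := by simp

theorem Equiv.Perm.eq_of_lt_iff_lt {n : ℕ} {e e' : Equiv.Perm (Fin n)}
    (h : ∀ i j, e i < e j ↔ e' i < e' j) : e = e' := by
  have hmono : StrictMono fun i => e' (e.symm i) := fun i j hij => (h _ _).1 (by simpa using hij)
  have hid : (fun i => e' (e.symm i)) = id :=
    (hmono.range_inj strictMono_id).1 (by
      rw [range_id]
      exact ((e.symm.trans e').surjective).range_eq)
  ext i
  have := congrFun hid (e i)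
  simp only [Equiv.symm_apply_apply, id_eq] at this
  rw [this]

/-- At most one permutation sorts a given family. -/
theorem Equiv.Perm.eq_of_strictMono_comp {n : ℕ} {α : Type*} [LinearOrder α] {y : Fin n → α}
    {e e' : Equiv.Perm (Fin n)} (h : StrictMono (y ∘ e)) (h' : StrictMono (y ∘ e')) : e = e' := by
  have hy : Function.Injective y := by
    have := h.injective.comp e.symm.injective
    simpa [Function.comp_assoc] using this
  have heq : y ∘ e = y ∘ e' := (h.range_inj h').1 (by
    rw [e.surjective.range_comp, e'.surjective.range_comp])
  ext i
  rw [hy (congrFun heq i)]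

/-- An injective family can be sorted. -/
theorem exists_perm_strictMono_comp {n : ℕ} {α : Type*} [LinearOrder α] {y : Fin n → α}
    (hy : Function.Injective y) : ∃ e : Equiv.Perm (Fin n), StrictMono (y ∘ e) :=
  ⟨Tuple.sort y, (Tuple.monotone_sort y).strictMono_of_injective
    (hy.comp (Tuple.sort y).injective)⟩

end Combinatorics

/-! ### Entropy bounds for finite partitions -/

section Gibbs

/-- **Gibbs' inequality**: coding with the weights `q s / M` costs at least the entropy. -/
theorem sum_negMulLog_le_of_sum_le {S : Type*} [Fintype S] {t q : S → ℝ} {M : ℝ}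
    (ht : ∀ s, 0 ≤ t s) (hts : ∑ s, t s = 1) (hq : ∀ s, 0 ≤ q s) (hqt : ∀ s, 0 < t s → 0 < q s)
    (hM : 0 < M) (hqs : ∑ s, q s ≤ M) :
    ∑ s, Real.negMulLog (t s) ≤ ∑ s, t s * (-Real.log (q s)) + Real.log M := by
  have h : ∀ s, Real.negMulLog (t s) ≤
      t s * (-Real.log (q s)) + t s * Real.log M + (q s / M - t s) := by
    intro s
    rcases (ht s).eq_or_lt with h0 | h0
    · simp only [← h0, Real.negMulLog_zero, zero_mul, sub_zero, zero_add]
      exact div_nonneg (hq s) hM.le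
    -- The tangent bound `log u ≤ u - 1` at `u = q s / (M * t s)`; the error terms sum to `(∑ q) / M
    -- - 1 ≤ 0`.
    · have h1 := Real.log_le_sub_one_of_pos (div_pos (hqt s h0) (mul_pos hM h0))
      rw [Real.log_div (hqt s h0).ne' (mul_pos hM h0).ne', Real.log_mul hM.ne' h0.ne'] at h1
      have h2 := mul_le_mul_of_nonneg_left h1 h0.le
      have h3 : t s * (q s / (M * t s) - 1) = q s / M - t s := by field_simp
      rw [h3] at h2
      rw [Real.negMulLog]
      linarith
  calc _ ≤ ∑ s, (t s * (-Real.log (q s)) + t s * Real.log M + (q s / M - t s)) :=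
        Finset.sum_le_sum fun s _ => h s
    _ = ∑ s, t s * (-Real.log (q s)) + Real.log M + ((∑ s, q s) / M - 1) := by
        rw [Finset.sum_add_distrib, Finset.sum_add_distrib, Finset.sum_sub_distrib, hts,
          ← Finset.sum_mul, hts, one_mul, Finset.sum_div]
    _ ≤ _ := by
        have : (∑ s, q s) / M ≤ 1 := (div_le_one hM).2 hqs
        linarith

variable {Ω : Type*} [MeasurableSpace Ω] {P : Measure Ω} [IsProbabilityMeasure P]
  {S : Type*} [Fintype S] {A : S → Set Ω} {L : Ω → ℝ}

omit [IsProbabilityMeasure P] in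
theorem integral_eq_sum_setIntegral_of_ae_partition (hA : ∀ s, MeasurableSet (A s))
    (hdisj : Pairwise (Function.onFun Disjoint A)) (hcover : ∀ᵐ ω ∂P, ∃ s, ω ∈ A s)
    (hL : Integrable L P) : ∫ ω, L ω ∂P = ∑ s, ∫ ω in A s, L ω ∂P := by
  rw [← integral_iUnion_fintype hA hdisj fun s => hL.integrableOn]
  rw [Measure.restrict_eq_self_of_ae_mem]
  filter_upwards [hcover] with ω hω using mem_iUnion.2 hω

theorem sum_measureReal_eq_one_of_ae_partition (hA : ∀ s, MeasurableSet (A s))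
    (hdisj : Pairwise (Function.onFun Disjoint A)) (hcover : ∀ᵐ ω ∂P, ∃ s, ω ∈ A s) :
    ∑ s, P.real (A s) = 1 := by
  have := integral_eq_sum_setIntegral_of_ae_partition hA hdisj hcover
    (integrable_const (1 : ℝ))
  simpa using this.symm

/-- The entropy of a finite partition is at most the mean length `L` of a code, up to `log M`. -/
theorem sum_negMulLog_measureReal_le (hA : ∀ s, MeasurableSet (A s))
    (hdisj : Pairwise (Function.onFun Disjoint A)) (hcover : ∀ᵐ ω ∂P, ∃ s, ω ∈ A s)
    (hL : Integrable L P) {q : S → ℝ} {M : ℝ} (hM : 0 < M) (hq : ∀ s, 0 ≤ q s)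
    (hqs : ∑ s, q s ≤ M) (hLq : ∀ᵐ ω ∂P, ∀ s, ω ∈ A s → Real.exp (-L ω) ≤ q s) :
    ∑ s, Real.negMulLog (P.real (A s)) ≤ ∫ ω, L ω ∂P + Real.log M := by
  have hpos : ∀ s, 0 < P.real (A s) → 0 < q s := by
    intro s hs
    by_contra hcon
    -- If `q s ≤ 0`, every point of `A s` violates `hLq`.
    have hnull : P (A s) = 0 := by
      refine measure_mono_null (t := {ω | ¬ ∀ s, ω ∈ A s → Real.exp (-L ω) ≤ q s}) ?_ hLq
      intro ω hω h
      exact hcon ((Real.exp_pos _).trans_le (h s hω))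
    simp [measureReal_def, hnull] at hs
  refine (sum_negMulLog_le_of_sum_le (fun s => measureReal_nonneg)
    (sum_measureReal_eq_one_of_ae_partition hA hdisj hcover) hq hpos hM hqs).trans ?_
  rw [integral_eq_sum_setIntegral_of_ae_partition hA hdisj hcover hL]
  gcongr with s
  have hc : P.real (A s) * (-Real.log (q s)) = ∫ _ in A s, -Real.log (q s) ∂P := by
    rw [setIntegral_const, smul_eq_mul]
  rw [hc]
  refine setIntegral_mono_on_ae (by simp) hL.integrableOn (hA s) ?_
  filter_upwards [hLq] with ω hω hs
  have := Real.log_le_log (Real.exp_pos _) (hω s hs)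
  rw [Real.log_exp] at this
  linarith

/-- The entropy of a finite partition is at least the mean of `L`, up to `log M`, when
`∑ s, P (A s) ∫_{A s} exp L ≤ M`. -/
theorem le_sum_negMulLog_measureReal (hA : ∀ s, MeasurableSet (A s))
    (hdisj : Pairwise (Function.onFun Disjoint A)) (hcover : ∀ᵐ ω ∂P, ∃ s, ω ∈ A s)
    (hL : Integrable L P) {M : ℝ} (hM : 0 < M)
    (hLM : ∀ s, ∫⁻ ω in A s, ENNReal.ofReal (Real.exp (L ω)) ∂P ≤ ENNReal.ofReal M) :
    ∫ ω, L ω ∂P - Real.log M ≤ ∑ s, Real.negMulLog (P.real (A s)) := by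
  have hexp : ∀ s, IntegrableOn (fun ω => Real.exp (L ω)) (A s) P := by
    intro s
    refine ⟨(Real.continuous_exp.comp_aestronglyMeasurable hL.aestronglyMeasurable).restrict, ?_⟩
    rw [hasFiniteIntegral_iff_ofReal (ae_of_all _ fun ω => (Real.exp_pos _).le)]
    exact (hLM s).trans_lt ENNReal.ofReal_lt_top
  have hint : ∀ s, ∫ ω in A s, Real.exp (L ω) ∂P ≤ M := by
    intro s
    rw [integral_eq_lintegral_of_nonneg_ae (ae_of_all _ fun ω => (Real.exp_pos _).le)
      (hexp s).aestronglyMeasurable]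
    exact ENNReal.toReal_le_of_le_ofReal hM.le (hLM s)
  have hsum := sum_measureReal_eq_one_of_ae_partition hA hdisj hcover
  have key : ∀ s, ∫ ω in A s, L ω ∂P ≤
      Real.negMulLog (P.real (A s)) + P.real (A s) * Real.log M := by
    intro s
    rcases (measureReal_nonneg (μ := P) (s := A s)).eq_or_lt with h0 | h0
    · have hnull : P (A s) = 0 := by
        simpa [measureReal_def, ENNReal.toReal_eq_zero_iff] using h0.symm
      rw [← h0, setIntegral_measure_zero _ hnull]
      simp
    set t := P.real (A s) with ht
    -- The tangent bound for `log` at `u = t * exp L / M`; integrated over `A s` it plays the role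
    -- of Jensen's inequality.
    have hle : ∀ ω, L ω ≤ t * Real.exp (L ω) / M - 1 + (Real.log M - Real.log t) := by
      intro ω
      have h1 := Real.log_le_sub_one_of_pos (div_pos (mul_pos h0 (Real.exp_pos (L ω))) hM)
      rw [Real.log_div (mul_pos h0 (Real.exp_pos _)).ne' hM.ne',
        Real.log_mul h0.ne' (Real.exp_pos _).ne', Real.log_exp] at h1
      linarith
    have hi : IntegrableOn (fun ω => t * Real.exp (L ω) / M) (A s) P :=
      ((hexp s).const_mul t).div_const M
    calc ∫ ω in A s, L ω ∂P
        ≤ ∫ ω in A s, (t * Real.exp (L ω) / M + (Real.log M - Real.log t - 1)) ∂P :=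
          setIntegral_mono hL.integrableOn (hi.add (by simp)) fun ω => by
            have := hle ω
            simp only
            linarith
      _ = t * (∫ ω in A s, Real.exp (L ω) ∂P) / M + t * (Real.log M - Real.log t - 1) := by
          rw [integral_add hi (by simp), integral_div, integral_const_mul, setIntegral_const,
            smul_eq_mul]
      _ ≤ t * M / M + t * (Real.log M - Real.log t - 1) := by
          gcongr
          exact hint s
      _ = _ := by
          rw [mul_div_assoc, div_self hM.ne', Real.negMulLog]
          ring
  rw [integral_eq_sum_setIntegral_of_ae_partition hA hdisj hcover hL]
  have := Finset.sum_le_sum fun s (_ : s ∈ Finset.univ) => key s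
  rw [Finset.sum_add_distrib, ← Finset.sum_mul, hsum, one_mul] at this
  linarith

end Gibbs

/-! ### Independent samples and product measures -/

section Product

variable {X : Type*} [MeasurableSpace X] {μ : Measure X} [IsProbabilityMeasure μ] {n : ℕ}

theorem lintegral_pi_prod_eq_prod {g : Fin n → X → ENNReal} (hg : ∀ i, Measurable (g i)) :
    ∫⁻ x, ∏ i, g i (x i) ∂(Measure.pi fun _ : Fin n => μ) = ∏ i, ∫⁻ x, g i x ∂μ := by
  have hind := ProbabilityTheory.iIndepFun_pi (μ := fun _ : Fin n => μ) (X := g)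
    fun i => (hg i).aemeasurable
  have h := ProbabilityTheory.lintegral_prod_eq_prod_lintegral_of_indepFun Finset.univ _ hind
    fun i => (hg i).comp (measurable_pi_apply i)
  rw [h]
  refine Finset.prod_congr rfl fun i _ => ?_
  exact (measurePreserving_eval (fun _ : Fin n => μ) i).lintegral_comp (hg i)

/-- If the branches `f : {j = k} → X`, weighted by `w`, push `μ` to measures below `μ`, the same
holds for their products. -/
theorem lintegral_pi_branch_le {K : Type*} [MeasurableSpace K] [MeasurableSingletonClass K]
    {f : X → X} (hf : Measurable f) {j : X → K} (hj : Measurable j) {w : X → ENNReal}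
    (hw : Measurable w)
    (h : ∀ k B, MeasurableSet B → ∫⁻ x in j ⁻¹' {k} ∩ f ⁻¹' B, w x ∂μ ≤ μ B)
    (J : Fin n → K) {B : Set (Fin n → X)} (hB : MeasurableSet B) :
    ∫⁻ x in {x | ∀ i, j (x i) = J i} ∩ (fun x i => f (x i)) ⁻¹' B, ∏ i, w (x i)
      ∂(Measure.pi fun _ : Fin n => μ) ≤ Measure.pi (fun _ : Fin n => μ) B := by
  have hF : Measurable fun (x : Fin n → X) i => f (x i) := by fun_prop
  have hJ : MeasurableSet {x : Fin n → X | ∀ i, j (x i) = J i} := by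
    simp only [Set.ofPred_forall]
    exact MeasurableSet.iInter fun i =>
      (hj.comp (measurable_pi_apply i)) (measurableSet_singleton (J i))
  set P := Measure.pi fun _ : Fin n => μ with hP
  set θ := ((P.restrict {x | ∀ i, j (x i) = J i}).withDensity fun x => ∏ i, w (x i)).map
    (fun x i => f (x i)) with hθ
  have hθB : ∀ B, MeasurableSet B → θ B =
      ∫⁻ x in {x | ∀ i, j (x i) = J i} ∩ (fun x i => f (x i)) ⁻¹' B, ∏ i, w (x i) ∂P := by
    intro B hB
    rw [hθ, Measure.map_apply hF hB, withDensity_apply _ (hF hB),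
      Measure.restrict_restrict (hF hB), inter_comm]
  rw [← hθB B hB]
  -- `OuterMeasure.pi` is the largest outer measure bounded on boxes by the product of the side
  -- measures, so only boxes need testing. Their sides may be non-measurable, hence the measurable
  -- hulls.
  have hle : θ.toOuterMeasure ≤ OuterMeasure.pi fun _ : Fin n => μ.toOuterMeasure := by
    refine OuterMeasure.le_pi.2 fun s _ => ?_
    have hs : MeasurableSet (univ.pi fun i => toMeasurable μ (s i)) :=
      MeasurableSet.univ_pi fun i => measurableSet_toMeasurable _ _
    calc θ (univ.pi s) ≤ θ (univ.pi fun i => toMeasurable μ (s i)) :=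
          measure_mono (pi_mono fun i _ => subset_toMeasurable _ _)
      _ = ∫⁻ x, ∏ i, (j ⁻¹' {J i} ∩ f ⁻¹' toMeasurable μ (s i)).indicator w (x i) ∂P := by
          rw [hθB _ hs, ← lintegral_indicator (hJ.inter (hF hs))]
          congr 1 with x
          by_cases hx : ∀ i, x i ∈ j ⁻¹' {J i} ∩ f ⁻¹' toMeasurable μ (s i)
          · rw [indicator_of_mem]
            · exact Finset.prod_congr rfl fun i _ => (indicator_of_mem (hx i) _).symm
            · exact ⟨fun i => (hx i).1, fun i _ => (hx i).2⟩
          · rw [indicator_of_notMem]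
            · obtain ⟨i, hi⟩ := not_forall.1 hx
              exact (Finset.prod_eq_zero (Finset.mem_univ i) (indicator_of_notMem hi _)).symm
            · rintro ⟨h1, h2⟩
              exact hx fun i => ⟨h1 i, h2 i (mem_univ i)⟩
      _ = ∏ i, ∫⁻ x in j ⁻¹' {J i} ∩ f ⁻¹' toMeasurable μ (s i), w x ∂μ := by
          have hm : ∀ i, MeasurableSet (j ⁻¹' {J i} ∩ f ⁻¹' toMeasurable μ (s i)) := fun i =>
            (hj (measurableSet_singleton _)).inter (hf (measurableSet_toMeasurable _ _))
          rw [hP, lintegral_pi_prod_eq_prod fun i => hw.indicator (hm i)]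
          exact Finset.prod_congr rfl fun i _ => lintegral_indicator (hm i) _
      _ ≤ ∏ i, μ (toMeasurable μ (s i)) := by
          gcongr with i
          exact h _ _ (measurableSet_toMeasurable _ _)
      _ = ∏ i, μ (s i) := by simp only [measure_toMeasurable]
  have := hle B
  have hP_apply : P B = OuterMeasure.pi (fun _ : Fin n => μ.toOuterMeasure) B := by
    rw [hP, Measure.pi_def, toMeasure_apply _ _ hB]
  rw [hP_apply]
  exact this

/-- Independent samples of an atomless law are almost surely pairwise distinct. -/
theorem ae_injective_pi [MeasurableEq X] [MeasurableSingletonClass X]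
    [NullSingletonClass μ] :
    ∀ᵐ x ∂(Measure.pi fun _ : Fin n => μ), Function.Injective x := by
  have h : ∀ i k : Fin n, i ≠ k → ∀ᵐ x ∂(Measure.pi fun _ : Fin n => μ), x i ≠ x k := by
    intro i k hik
    have hind := (ProbabilityTheory.iIndepFun_pi (μ := fun _ : Fin n => μ)
      (X := fun _ x => x) fun i => aemeasurable_id).indepFun hik
    have hmap := (ProbabilityTheory.indepFun_iff_map_prod_eq_prod_map_map
      (measurable_pi_apply i).aemeasurable (measurable_pi_apply k).aemeasurable).1 hind
    have heval : ∀ l : Fin n, (Measure.pi fun _ : Fin n => μ).map (fun x => x l) = μ := fun l =>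
      (measurePreserving_eval (fun _ : Fin n => μ) l).map_eq
    rw [heval, heval] at hmap
    have hd : (μ.prod μ) (diagonal X) = 0 := by
      rw [Measure.measure_prod_null measurableSet_diagonal]
      refine ae_of_all _ fun x => ?_
      have : Prod.mk x ⁻¹' diagonal X = {x} := by ext y; simp [eq_comm]
      simp [this]
    rw [← hmap, Measure.map_apply ((measurable_pi_apply i).prodMk (measurable_pi_apply k))
      measurableSet_diagonal] at hd
    rw [ae_iff]
    refine measure_mono_null (fun x hx => ?_) hd
    simpa using hx
  have h' : ∀ᵐ x ∂(Measure.pi fun _ : Fin n => μ), ∀ i k : Fin n, i ≠ k → x i ≠ x k := by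
    simp only [ae_all_iff]
    exact h
  filter_upwards [h'] with x hx i k hik
  by_contra hne
  exact hx i k hne hik

end Product

/-! ### Patterns as events for uniform abscissae -/

section Pattern

variable {n : ℕ}

/-- The permutation `ρ` lists the points by increasing height, and `ρ ∘ σ` from left to right. -/
theorem mem_patternSet_iff {σ : Equiv.Perm (Fin n)} {p : Fin n → unitInterval × unitInterval} :
    p ∈ patternSet σ ↔ ∃ ρ : Equiv.Perm (Fin n),
      StrictMono (fun r => (p (ρ r)).2) ∧ StrictMono (fun i => (p (ρ (σ i))).1) := by
  constructor
  · rintro ⟨τ, h1, h2⟩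
    refine ⟨σ.symm.trans τ, fun r r' hr => ?_, ?_⟩
    · exact (h2 _ _).2 (by simpa using hr)
    · simpa using h1
  · rintro ⟨ρ, h1, h2⟩
    exact ⟨σ.trans ρ, h2, fun i j => h1.lt_iff_lt⟩

theorem measurableSet_setOf_strictMono {Z : Type*} [MeasurableSpace Z]
    {u : Fin n → Z → unitInterval} (hu : ∀ i, Measurable (u i)) :
    MeasurableSet {z | StrictMono fun i => u i z} := by
  have : {z | StrictMono fun i => u i z} = ⋂ i, ⋂ j, ⋂ _ : i < j, {z | u i z < u j z} := by
    ext z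
    simp [StrictMono]
  rw [this]
  exact MeasurableSet.iInter fun i => MeasurableSet.iInter fun j => MeasurableSet.iInter fun _ =>
    measurableSet_lt (hu i) (hu j)

theorem measurableSet_patternSet (σ : Equiv.Perm (Fin n)) : MeasurableSet (patternSet σ) := by
  have : patternSet σ = ⋃ ρ : Equiv.Perm (Fin n),
      {p : Fin n → unitInterval × unitInterval | StrictMono fun r => (p (ρ r)).2} ∩
        {p | StrictMono fun i => (p (ρ (σ i))).1} := by
    ext p
    rw [mem_patternSet_iff]
    simp
  rw [this]
  exact MeasurableSet.iUnion fun ρ => (measurableSet_setOf_strictMono fun i => by fun_prop).inter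
    (measurableSet_setOf_strictMono fun i => by fun_prop)

/-- The heights determine the sorting permutation `ρ`, and the abscissae then determine `ρ ∘ σ`. -/
theorem pairwise_disjoint_patternSet :
    Pairwise (Function.onFun Disjoint (patternSet (n := n))) := by
  intro σ σ' hne
  refine Set.disjoint_left.2 fun p hp hp' => hne ?_
  obtain ⟨ρ, h1, h2⟩ := mem_patternSet_iff.1 hp
  obtain ⟨ρ', h1', h2'⟩ := mem_patternSet_iff.1 hp'
  obtain rfl : ρ = ρ' := Equiv.Perm.eq_of_strictMono_comp (y := fun i => (p i).2) h1 h1'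
  have h : σ.trans ρ = σ'.trans ρ :=
    Equiv.Perm.eq_of_strictMono_comp (y := fun i => (p i).1) h2 h2'
  ext i
  have := congrArg (fun e => ρ.symm (e i)) h
  simpa using congrArg Fin.val this

theorem exists_mem_patternSet {p : Fin n → unitInterval × unitInterval}
    (h1 : Function.Injective fun i => (p i).1) (h2 : Function.Injective fun i => (p i).2) :
    ∃ σ : Equiv.Perm (Fin n), p ∈ patternSet σ := by
  obtain ⟨e, he⟩ := exists_perm_strictMono_comp h1
  obtain ⟨ρ, hρ⟩ := exists_perm_strictMono_comp h2
  exact ⟨e.trans ρ.symm, mem_patternSet_iff.2 ⟨ρ, hρ, by simpa [Function.comp_def] using he⟩⟩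

/-- The event that independent uniform abscissae `x` produce the pattern `σ` on the graph of `f`. -/
def patternEvent (f : unitInterval → unitInterval) (σ : Equiv.Perm (Fin n)) :
    Set (Fin n → unitInterval) :=
  {x | (fun i => (x i, f (x i))) ∈ patternSet σ}

variable {f : unitInterval → unitInterval} {σ : Equiv.Perm (Fin n)}

theorem mem_patternEvent_iff {x : Fin n → unitInterval} :
    x ∈ patternEvent f σ ↔ ∃ ρ : Equiv.Perm (Fin n),
      StrictMono (fun r => f (x (ρ r))) ∧ StrictMono (fun i => x (ρ (σ i))) :=
  mem_patternSet_iff (p := fun i => (x i, f (x i)))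

theorem measurableSet_patternEvent (hf : Measurable f) (σ : Equiv.Perm (Fin n)) :
    MeasurableSet (patternEvent f σ) :=
  (show Measurable fun (x : Fin n → unitInterval) i => (x i, f (x i)) by fun_prop)
    (measurableSet_patternSet σ)

theorem pairwise_disjoint_patternEvent :
    Pairwise (Function.onFun Disjoint (patternEvent (n := n) f)) := fun _ _ hne =>
  (pairwise_disjoint_patternSet hne).preimage _

theorem ae_exists_mem_patternEvent (hf : MeasurePreserving f volume volume) :
    ∀ᵐ x ∂(Measure.pi fun _ : Fin n => (volume : Measure unitInterval)),
      ∃ σ, x ∈ patternEvent f σ := by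
  -- The heights are again independent and uniform, so ties are null in both coordinates.
  have hF := measurePreserving_pi (fun _ : Fin n => (volume : Measure unitInterval))
    (fun _ => volume) fun _ => hf
  filter_upwards [ae_injective_pi (μ := (volume : Measure unitInterval)),
    hF.quasiMeasurePreserving.ae (ae_injective_pi (μ := (volume : Measure unitInterval)))]
    with x hx hfx
  exact exists_mem_patternSet (p := fun i => (x i, f (x i))) hx hfx

theorem Permuton.density_ofMap (hf : MeasurePreserving f volume volume)
    (σ : Equiv.Perm (Fin n)) :
    (Permuton.ofMap f hf).density σ =
      (Measure.pi fun _ : Fin n => (volume : Measure unitInterval)).real (patternEvent f σ) := by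
  have hm : Measurable fun x => (x, f x) := measurable_id.prodMk hf.measurable
  have hm' : Measurable fun (x : Fin n → unitInterval) i => (x i, f (x i)) :=
    measurable_pi_lambda _ fun i => hm.comp (measurable_pi_apply i)
  have hprob : IsProbabilityMeasure ((volume : Measure unitInterval).map fun x => (x, f x)) :=
    Measure.isProbabilityMeasure_map hm.aemeasurable
  have h := Measure.pi_map_pi (μ := fun _ : Fin n => (volume : Measure unitInterval))
    (f := fun _ x => (x, f x)) fun _ => hm.aemeasurable
  rw [Permuton.density, Permuton.ofMap, measureReal_def, measureReal_def, ← h,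
    Measure.map_apply hm' (measurableSet_patternSet σ)]
  rfl

end Pattern

/-! ### Grid cells, expanding branches and branch codes -/

/-- The cell of the regular grid with mesh `1 / m` that contains a given point. -/
noncomputable def gridCell (m : ℕ) (y : unitInterval) : Fin (m + 1) :=
  ⟨⌊(m : ℝ) * y⌋₊, Nat.lt_succ_of_le <| Nat.floor_le_of_le <|
    mul_le_of_le_one_right m.cast_nonneg y.2.2⟩

theorem monotone_gridCell (m : ℕ) : Monotone (gridCell m) := fun _ _ h =>
  Fin.mk_le_mk.2 (Nat.floor_mono (mul_le_mul_of_nonneg_left h m.cast_nonneg))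

/-- The expanding monotone branches of a map of the unit interval. Up to a null set, the branches
occupy successive intervals, `f` is strictly monotone on each of them with slope `≥ 1`, and the
conditional density of the branch of a point, given its height, is the reciprocal of the slope. -/
structure ExpandingBranches (f : unitInterval → unitInterval) (N : ℕ) where
  /-- The branch to which a point belongs. -/
  branch : unitInterval → Fin N
  measurable_branch : Measurable branch
  /-- The absolute value of the slope. -/
  slope : unitInterval → ℝ
  measurable_slope : Measurable slope
  one_le_slope : ∀ x, 1 ≤ slope x
  /-- The increasing branches. -/
  incr : Fin N → Prop
  /-- The points in the interior of a branch. -/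
  good : Set unitInterval
  ae_good : ∀ᵐ x, x ∈ good
  lt_iff : ∀ x ∈ good, ∀ y ∈ good, x < y ↔ branch x < branch y ∨
    branch x = branch y ∧ (incr (branch x) ∧ f x < f y ∨ ¬ incr (branch x) ∧ f y < f x)
  -- Input of the lower entropy bound; an inequality suffices.
  lintegral_slope_le : ∀ k B, MeasurableSet B →
    ∫⁻ x in branch ⁻¹' {k} ∩ f ⁻¹' B, ENNReal.ofReal (slope x) ≤ volume B
  -- Input of the upper bound: cell densities are asymptotically no smaller than the reciprocal
  -- slope.
  eventually_le_density : ∀ᵐ x, ∀ ε > 0, ∀ᶠ m in atTop, (slope x + ε)⁻¹ ≤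
    volume.real (branch ⁻¹' {branch x} ∩ f ⁻¹' (gridCell m ⁻¹' {gridCell m (f x)})) /
      volume.real (gridCell m ⁻¹' {gridCell m (f x)})

/-- The left-to-right order of points listed by increasing height, read off from their branches
`w`. -/
def BranchLT {n N : ℕ} (incr : Fin N → Prop) (w : Fin n → Fin N) (r s : Fin n) : Prop :=
  w r < w s ∨ w r = w s ∧ (incr (w r) ∧ r < s ∨ ¬ incr (w r) ∧ s < r)

open Classical in
/-- The total weight of the codes of a pattern is at most the number of monotone cell sequences. -/
theorem sum_branch_code_le {n m N : ℕ} (incr : Fin N → Prop) {r : Fin m → Fin N → ℝ}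
    (hr : ∀ b k, 0 ≤ r b k) (hsum : ∀ b, ∑ k, r b k ≤ 1) :
    ∑ σ : Equiv.Perm (Fin n), ∑ w : Fin n → Fin N with
        ∀ i j, σ.symm i < σ.symm j ↔ BranchLT incr w i j,
      ∑ b : Fin n → Fin m with Monotone b, ∏ i, r (b i) (w i) ≤ ((n : ℝ) + 1) ^ m := by
  have hnn : ∀ w : Fin n → Fin N, 0 ≤ ∑ b : Fin n → Fin m with Monotone b, ∏ i, r (b i) (w i) :=
    fun w => Finset.sum_nonneg fun b _ => Finset.prod_nonneg fun i _ => hr _ _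
  simp_rw [Finset.sum_filter (p := fun w : Fin n → Fin N => ∀ i j, _ ↔ BranchLT incr w i j)]
  rw [Finset.sum_comm]
  calc _ ≤ ∑ w : Fin n → Fin N, ∑ b : Fin n → Fin m with Monotone b, ∏ i, r (b i) (w i) := by
        gcongr with w
        rw [← Finset.sum_filter, Finset.sum_const, nsmul_eq_mul]
        refine mul_le_of_le_one_left (hnn w) ?_
        -- A word fixes the order `BranchLT`, hence `σ.symm`: it codes at most one pattern.
        exact_mod_cast Finset.card_le_one.2 fun σ hσ σ' hσ' => by
          simp only [Finset.mem_filter, Finset.mem_univ, true_and] at hσ hσ'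
          have : σ.symm = σ'.symm :=
            Equiv.Perm.eq_of_lt_iff_lt fun i j => (hσ i j).trans (hσ' i j).symm
          exact Equiv.symm_bijective.injective this
    _ = ∑ b : Fin n → Fin m with Monotone b, ∏ i, ∑ k, r (b i) k := by
        rw [Finset.sum_comm]
        refine Finset.sum_congr rfl fun b _ => ?_
        -- For fixed cells, the sum over all words factorises over the points.
        rw [Finset.prod_univ_sum, Fintype.piFinset_univ]
    _ ≤ ∑ b : Fin n → Fin m with Monotone b, 1 := by
        gcongr with b
        exact Finset.prod_le_one (fun i _ => Finset.sum_nonneg fun k _ => hr _ _)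
          fun i _ => hsum _
    _ ≤ ((n : ℝ) + 1) ^ m := by
        rw [Finset.sum_const, nsmul_eq_mul, mul_one]
        exact_mod_cast card_monotone_fin_le n m

theorem integrable_pi_sum {X : Type*} [MeasurableSpace X] {μ : Measure X} [IsProbabilityMeasure μ]
    {ℓ : X → ℝ} (hℓ : Integrable ℓ μ) (n : ℕ) :
    Integrable (fun x => ∑ i, ℓ (x i)) (Measure.pi fun _ : Fin n => μ) :=
  integrable_finsetSum _ fun _ _ => integrable_comp_eval hℓ

theorem integral_pi_sum {X : Type*} [MeasurableSpace X] {μ : Measure X} [IsProbabilityMeasure μ]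
    {ℓ : X → ℝ} (hℓ : Integrable ℓ μ) (n : ℕ) :
    ∫ x, ∑ i, ℓ (x i) ∂(Measure.pi fun _ : Fin n => μ) = n * ∫ x, ℓ x ∂μ := by
  rw [integral_finsetSum _ fun i _ => integrable_comp_eval hℓ]
  have h : ∀ i : Fin n, ∫ x, ℓ (x i) ∂(Measure.pi fun _ : Fin n => μ) = ∫ x, ℓ x ∂μ := fun i =>
    integral_comp_eval (μ := fun _ : Fin n => μ) hℓ.aestronglyMeasurable
  simp [h]

theorem ae_pi_forall {X : Type*} [MeasurableSpace X] {μ : Measure X} [IsProbabilityMeasure μ]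
    {p : X → Prop} (h : ∀ᵐ x ∂μ, p x) (n : ℕ) :
    ∀ᵐ x ∂(Measure.pi fun _ : Fin n => μ), ∀ i, p (x i) := by
  rw [ae_all_iff]
  exact fun i =>
    (measurePreserving_eval (fun _ : Fin n => μ) i).quasiMeasurePreserving.ae h

/-! ### Upper and lower entropy bounds -/

namespace ExpandingBranches

variable {f : unitInterval → unitInterval} {N : ℕ} (β : ExpandingBranches f N)

/-- Each branch contributes at most `volume univ = 1`, so the total is at most `N`, however
unbounded the slope. Integrability of its logarithm follows from `0 ≤ log s ≤ s - 1`. -/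
theorem integrable_slope : Integrable β.slope := by
  refine ⟨β.measurable_slope.aestronglyMeasurable, ?_⟩
  rw [hasFiniteIntegral_iff_ofReal (ae_of_all _ fun x => zero_le_one.trans (β.one_le_slope x))]
  have hU : ⋃ k, β.branch ⁻¹' {k} = univ := by
    ext x
    simp
  rw [← setLIntegral_univ, ← hU]
  refine (lintegral_iUnion_le _ _).trans_lt ?_
  rw [tsum_fintype]
  refine ENNReal.sum_lt_top.2 fun k _ => ?_
  have := β.lintegral_slope_le k univ MeasurableSet.univ
  rw [preimage_univ, inter_univ] at this
  exact this.trans_lt (measure_lt_top _ _)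

theorem log_slope_nonneg (x : unitInterval) : 0 ≤ Real.log (β.slope x) :=
  Real.log_nonneg (β.one_le_slope x)

theorem integrable_log_slope : Integrable fun x => Real.log (β.slope x) := by
  refine β.integrable_slope.mono' (Real.measurable_log.comp β.measurable_slope).aestronglyMeasurable
    (ae_of_all _ fun x => ?_)
  rw [Real.norm_of_nonneg (β.log_slope_nonneg x)]
  have := Real.log_le_sub_one_of_pos (zero_lt_one.trans_le (β.one_le_slope x))
  linarith

theorem integrable_comp_cell_branch (hf : Measurable f) {m : ℕ} {c : unitInterval → Fin m}
    (hc : Measurable c) (h : Fin m → Fin N → ℝ) :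
    Integrable fun x => h (c (f x)) (β.branch x) := by
  refine Integrable.of_bound (C := ∑ b, ∑ k, |h b k|) ?_ (ae_of_all _ fun x => ?_)
  · have h1 : Measurable (Function.uncurry h) := Measurable.of_discrete
    exact (h1.comp ((hc.comp hf).prodMk β.measurable_branch)).aestronglyMeasurable
  · rw [Real.norm_eq_abs]
    exact (Finset.single_le_sum (f := fun k => |h (c (f x)) k|) (fun _ _ => abs_nonneg _)
      (Finset.mem_univ (β.branch x))).trans (Finset.single_le_sum (f := fun b => ∑ k, |h b k|)
        (fun _ _ => Finset.sum_nonneg fun _ _ => abs_nonneg _) (Finset.mem_univ _))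

/-- Coding the branches by weights that depend on the cell of the height bounds the sampling entropy
from above. -/
theorem samplingEntropy_le (hf : MeasurePreserving f volume volume) {m : ℕ}
    {c : unitInterval → Fin m} (hc : Monotone c) (hcm : Measurable c) {r : Fin m → Fin N → ℝ}
    (hr : ∀ b k, 0 < r b k) (hsum : ∀ b, ∑ k, r b k ≤ 1) (n : ℕ) :
    (Permuton.ofMap f hf).samplingEntropy n ≤
      n * (∫ x, -Real.log (r (c (f x)) (β.branch x))) + m * Real.log (n + 1) := by
  classical
  have hint := β.integrable_comp_cell_branch hf.measurable hcm fun b k => -Real.log (r b k)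
  have hcode := sum_branch_code_le (n := n) β.incr (fun b k => (hr b k).le) hsum
  have h := sum_negMulLog_measureReal_le (measurableSet_patternEvent hf.measurable)
    pairwise_disjoint_patternEvent (ae_exists_mem_patternEvent hf) (integrable_pi_sum hint n)
    (by positivity) (fun σ => Finset.sum_nonneg fun w _ => Finset.sum_nonneg fun b _ =>
      Finset.prod_nonneg fun i _ => (hr _ _).le) hcode ?_
  · rw [integral_pi_sum hint, Real.log_pow] at h
    simpa only [Permuton.samplingEntropy, Permuton.density_ofMap] using h
  · filter_upwards [ae_pi_forall β.ae_good n] with x hx σ hσ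
    obtain ⟨ρ, h1, h2⟩ := mem_patternEvent_iff.1 hσ
    rw [← Finset.sum_neg_distrib, Real.exp_sum]
    simp only [neg_neg, Real.exp_log (hr _ _)]
    -- Reindexed by increasing height, the weight of the sample is one term of the nonnegative
    -- double sum: the one at its own branch word and cell word.
    rw [← Equiv.prod_comp ρ]
    have hw : (fun i => β.branch (x (ρ i))) ∈ Finset.univ.filter fun w : Fin n → Fin N =>
        ∀ i j, σ.symm i < σ.symm j ↔ BranchLT β.incr w i j := by
      simp only [Finset.mem_filter, Finset.mem_univ, true_and]
      intro i j
      have hij := h2.lt_iff_lt (a := σ.symm i) (b := σ.symm j)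
      simp only [Equiv.apply_symm_apply] at hij
      rw [← hij, β.lt_iff _ (hx _) _ (hx _), h1.lt_iff_lt, h1.lt_iff_lt]
      rfl
    have hb : (fun i => c (f (x (ρ i)))) ∈ Finset.univ.filter fun b : Fin n → Fin m =>
        Monotone b := by
      simp only [Finset.mem_filter, Finset.mem_univ, true_and]
      exact hc.comp h1.monotone
    refine le_trans ?_ (Finset.single_le_sum (f := fun w : Fin n → Fin N =>
      ∑ b : Fin n → Fin m with Monotone b, ∏ i, r (b i) (w i))
      (fun w _ => Finset.sum_nonneg fun b _ => Finset.prod_nonneg fun i _ => (hr _ _).le) hw)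
    exact Finset.single_le_sum (f := fun b : Fin n → Fin m =>
      ∏ i, r (b i) (β.branch (x (ρ i))))
      (fun b _ => Finset.prod_nonneg fun i _ => (hr _ _).le) hb

open Classical in
/-- Given the heights, a pattern determines the branches up to `(n + 1) ^ N` choices. -/
theorem card_branches_le {n : ℕ} (y : Fin n → unitInterval) (σ : Equiv.Perm (Fin n)) :
    (Finset.univ.filter fun J : Fin n → Fin N => ∃ ρ : Equiv.Perm (Fin n),
      StrictMono (fun r => y (ρ r)) ∧ Monotone fun i => J (ρ (σ i))).card ≤ (n + 1) ^ N := by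
  by_cases hy : ∃ ρ : Equiv.Perm (Fin n), StrictMono fun r => y (ρ r)
  · obtain ⟨ρ, hρ⟩ := hy
    refine le_trans ?_ (card_monotone_fin_le n N)
    -- The heights fix `ρ`, so `J` is recovered from the monotone word `J ∘ ρ ∘ σ`.
    refine Finset.card_le_card_of_injOn (fun J i => J (ρ (σ i))) ?_ ?_
    · intro J hJ
      simp only [Finset.coe_filter, Finset.mem_univ, true_and, mem_ofPred_eq] at hJ ⊢
      obtain ⟨ρ', h1, h2⟩ := hJ
      obtain rfl : ρ = ρ' := Equiv.Perm.eq_of_strictMono_comp (y := y) hρ h1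
      exact h2
    · intro J _ J' _ h
      funext i
      have := congrFun h (σ.symm (ρ.symm i))
      simpa using this
  · rw [Finset.filter_false_of_mem]
    · simp
    · rintro J - ⟨ρ, h1, -⟩
      exact hy ⟨ρ, h1⟩

/-- Splitting by the branch assignment `J`, the slope weights cancel the Jacobian and leave the
measure of the heights compatible with `J` and `σ`. By `card_branches_le`, a height vector is
compatible with at most `(n + 1) ^ N` assignments. -/
theorem lintegral_patternEvent_le (hf : Measurable f) {n : ℕ} (σ : Equiv.Perm (Fin n)) :
    ∫⁻ x in patternEvent f σ, ∏ i, ENNReal.ofReal (β.slope (x i))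
      ∂(Measure.pi fun _ : Fin n => (volume : Measure unitInterval)) ≤ (n + 1) ^ N := by
  classical
  set P := Measure.pi fun _ : Fin n => (volume : Measure unitInterval) with hP
  let C : (Fin n → Fin N) → Set (Fin n → unitInterval) := fun J =>
    {y | ∃ ρ : Equiv.Perm (Fin n), StrictMono (fun r => y (ρ r)) ∧ Monotone fun i => J (ρ (σ i))}
  have hC : ∀ J, MeasurableSet (C J) := by
    intro J
    have : C J = ⋃ ρ : Equiv.Perm (Fin n), ⋃ _ : Monotone fun i => J (ρ (σ i)),
        {y | StrictMono fun r => y (ρ r)} := by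
      ext y
      simp [C, and_comm]
    rw [this]
    exact MeasurableSet.iUnion fun ρ => MeasurableSet.iUnion fun _ =>
      measurableSet_setOf_strictMono fun i => by fun_prop
  have hsub : patternEvent f σ ∩ {x | ∀ i, x i ∈ β.good} ⊆
      ⋃ J, {x | ∀ i, β.branch (x i) = J i} ∩ (fun x i => f (x i)) ⁻¹' C J := by
    rintro x ⟨hx, hgood⟩
    obtain ⟨ρ, h1, h2⟩ := mem_patternEvent_iff.1 hx
    refine mem_iUnion.2 ⟨fun i => β.branch (x i), fun i => rfl, ρ, h1, fun i j hij => ?_⟩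
    rcases hij.eq_or_lt with rfl | hij
    · exact le_rfl
    · rcases (β.lt_iff _ (hgood _) _ (hgood _)).1 (h2 hij) with h | h
      · exact h.le
      · exact h.1.le
  have hrestr : P.restrict (patternEvent f σ) ≤
      P.restrict (⋃ J, {x | ∀ i, β.branch (x i) = J i} ∩ (fun x i => f (x i)) ⁻¹' C J) := by
    refine Measure.restrict_mono_ae ?_
    filter_upwards [ae_pi_forall β.ae_good n] with x hx hxσ using hsub ⟨hxσ, hx⟩
  calc _ ≤ ∑ J : Fin n → Fin N, P (C J) := by
        refine (lintegral_mono' hrestr le_rfl).trans ((lintegral_iUnion_le _ _).trans ?_)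
        rw [tsum_fintype]
        exact Finset.sum_le_sum fun J _ => lintegral_pi_branch_le hf β.measurable_branch
          (ENNReal.measurable_ofReal.comp β.measurable_slope) β.lintegral_slope_le J (hC J)
    _ = ∫⁻ y, ∑ J : Fin n → Fin N, (C J).indicator 1 y ∂P := by
        rw [lintegral_finsetSum _ fun J _ => measurable_one.indicator (hC J)]
        simp only [lintegral_indicator_one (hC _)]
    _ ≤ ∫⁻ _, (n + 1) ^ N ∂P := by
        refine lintegral_mono fun y => ?_
        have h := card_branches_le (N := N) y σ
        rw [Finset.card_filter] at h
        simp only [indicator_apply, Pi.one_apply]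
        exact_mod_cast h
    _ = (n + 1) ^ N := by simp [hP]

theorem le_samplingEntropy (hf : MeasurePreserving f volume volume) (n : ℕ) :
    n * (∫ x, Real.log (β.slope x)) - N * Real.log (n + 1) ≤
      (Permuton.ofMap f hf).samplingEntropy n := by
  have h := le_sum_negMulLog_measureReal (measurableSet_patternEvent hf.measurable)
    pairwise_disjoint_patternEvent (ae_exists_mem_patternEvent hf)
    (integrable_pi_sum β.integrable_log_slope n) (M := ((n : ℝ) + 1) ^ N) (by positivity) ?_
  · rw [integral_pi_sum β.integrable_log_slope, Real.log_pow] at h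
    simpa only [Permuton.samplingEntropy, Permuton.density_ofMap] using h
  · intro σ
    have hpos : ∀ x, 0 < β.slope x := fun x => zero_lt_one.trans_le (β.one_le_slope x)
    have hM : ENNReal.ofReal (((n : ℝ) + 1) ^ N) = ((n : ENNReal) + 1) ^ N := by
      rw [ENNReal.ofReal_pow (by positivity), ENNReal.ofReal_add (by positivity) zero_le_one]
      simp
    rw [hM]
    refine le_trans (le_of_eq ?_) (β.lintegral_patternEvent_le hf.measurable σ)
    congr 1 with x
    rw [Real.exp_sum, ENNReal.ofReal_prod_of_nonneg fun i _ => (Real.exp_pos _).le]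
    simp only [Real.exp_log (hpos _)]

end ExpandingBranches

theorem tendsto_log_succ_div_atTop :
    Tendsto (fun n : ℕ => Real.log (n + 1) / n) atTop (𝓝 0) := by
  have h := (Real.tendsto_pow_log_div_mul_add_atTop 1 (-1) 1 one_ne_zero).comp
    (tendsto_natCast_atTop_atTop.comp (tendsto_add_atTop_nat 1))
  refine h.congr fun n => ?_
  simp

/-! ### Cell densities and the entropy limit -/

namespace ExpandingBranches

variable {f : unitInterval → unitInterval} {N : ℕ} (β : ExpandingBranches f N)

/-- The conditional probability of a branch, given the grid cell of the height. -/
noncomputable def cellDensity (m : ℕ) (b : Fin (m + 1)) (k : Fin N) : ℝ :=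
  (volume : Measure unitInterval).real (β.branch ⁻¹' {k} ∩ f ⁻¹' (gridCell m ⁻¹' {b})) /
    (volume : Measure unitInterval).real (gridCell m ⁻¹' {b})

theorem cellDensity_nonneg (m : ℕ) (b : Fin (m + 1)) (k : Fin N) : 0 ≤ β.cellDensity m b k :=
  div_nonneg measureReal_nonneg measureReal_nonneg

theorem sum_cellDensity_le_one (hf : MeasurePreserving f volume volume) (m : ℕ)
    (b : Fin (m + 1)) : ∑ k, β.cellDensity m b k ≤ 1 := by
  have hcell : MeasurableSet (gridCell m ⁻¹' {b}) :=
    (monotone_gridCell m).measurable (measurableSet_singleton b)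
  have h : ∑ k, (volume : Measure unitInterval).real
      (β.branch ⁻¹' {k} ∩ f ⁻¹' (gridCell m ⁻¹' {b})) =
      (volume : Measure unitInterval).real (gridCell m ⁻¹' {b}) := by
    rw [← hf.measureReal_preimage hcell.nullMeasurableSet, ← measureReal_iUnion_fintype]
    · congr 1
      ext x
      simp
    · intro k l hkl
      refine Set.disjoint_left.2 fun x hx hx' => hkl ?_
      rw [← mem_singleton_iff.1 hx.1, ← mem_singleton_iff.1 hx'.1]
    · exact fun k => (β.measurable_branch (measurableSet_singleton k)).inter (hf.measurable hcell)
  simp only [cellDensity]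
  rw [← Finset.sum_div, h]
  -- Only `≤`: over a null cell, such as `{1}` at the top when `m > 0`, all quotients are `0`.
  exact div_self_le_one _

/-- The mean code length of the smoothed cell densities approaches the mean log-slope. -/
theorem exists_weights (hf : MeasurePreserving f volume volume) {ε : ℝ} (hε : 0 < ε) :
    ∃ (m : ℕ) (r : Fin (m + 1) → Fin N → ℝ), (∀ b k, 0 < r b k) ∧ (∀ b, ∑ k, r b k ≤ 1) ∧
      ∫ x, -Real.log (r (gridCell m (f x)) (β.branch x)) ≤ (∫ x, Real.log (β.slope x)) + ε := by
  -- Adding `δ` keeps the weights positive and their logarithms bounded below; renormalising by `1 +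
  -- N * δ` costs `log (1 + N * δ) ≤ ε / 2`.
  set δ : ℝ := ε / (2 * (N + 1)) with hδ
  have hδ0 : 0 < δ := by positivity
  have hNδ : N * δ ≤ ε / 2 := by
    rw [hδ, ← mul_div_assoc, div_le_div_iff₀ (by positivity) (by positivity)]
    nlinarith
  have hpos : ∀ m b k, 0 < β.cellDensity m b k + δ := fun m b k =>
    add_pos_of_nonneg_of_pos (β.cellDensity_nonneg m b k) hδ0
  have hZ : 0 < 1 + N * δ := by positivity
  -- The excess code length. Its positive part suffices for an upper bound; it is dominated by `|log
  -- δ|` since the log-slope is nonnegative.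
  let e : ℕ → unitInterval → ℝ := fun m x =>
    max (-Real.log (β.cellDensity m (gridCell m (f x)) (β.branch x) + δ) -
      Real.log (β.slope x)) 0
  have hint : ∀ m (h : Fin (m + 1) → Fin N → ℝ),
      Integrable fun x => h (gridCell m (f x)) (β.branch x) := fun m h =>
    β.integrable_comp_cell_branch hf.measurable (monotone_gridCell m).measurable h
  have hei : ∀ m, Integrable (e m) := fun m =>
    ((hint m fun b k => -Real.log (β.cellDensity m b k + δ)).sub β.integrable_log_slope).pos_part
  have hlim : Tendsto (fun m => ∫ x, e m x) atTop (𝓝 (∫ _ : unitInterval, (0 : ℝ))) := by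
    refine tendsto_integral_of_dominated_convergence (fun _ => |Real.log δ|)
      (fun m => (hei m).aestronglyMeasurable) (integrable_const _) (fun m => ?_) ?_
    · refine ae_of_all _ fun x => ?_
      rw [Real.norm_of_nonneg (le_max_right _ _)]
      refine max_le ?_ (abs_nonneg _)
      have h1 := Real.log_le_log hδ0 (le_add_of_nonneg_left (a := δ)
        (β.cellDensity_nonneg m (gridCell m (f x)) (β.branch x)))
      have h2 := β.log_slope_nonneg x
      have h3 := neg_abs_le (Real.log δ)
      linarith
    · filter_upwards [β.eventually_le_density] with x hx
      rw [Metric.tendsto_atTop']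
      intro η hη
      have hs : 0 < β.slope x := zero_lt_one.trans_le (β.one_le_slope x)
      -- This tolerance turns `slope + ε` into `slope * exp (η / 2)`, so the excess is at most `η /
      -- 2`.
      have hη' : 0 < β.slope x * (Real.exp (η / 2) - 1) :=
        mul_pos hs (sub_pos.2 (Real.one_lt_exp_iff.2 (half_pos hη)))
      obtain ⟨m₀, hm₀⟩ := eventually_atTop.1 (hx _ hη')
      refine ⟨m₀, fun m hm => ?_⟩
      have h := hm₀ m hm.le
      have hexp : β.slope x + β.slope x * (Real.exp (η / 2) - 1) =
          β.slope x * Real.exp (η / 2) := by ring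
      rw [hexp] at h
      have h1 := Real.log_le_log (by positivity) (h.trans (le_add_of_nonneg_right hδ0.le))
      rw [Real.log_inv, Real.log_mul hs.ne' (Real.exp_pos _).ne', Real.log_exp] at h1
      rw [Real.dist_eq, sub_zero, abs_of_nonneg (le_max_right _ _)]
      refine max_lt ?_ hη
      simp only [cellDensity]
      linarith
  rw [integral_zero] at hlim
  obtain ⟨m, hm⟩ := (hlim.eventually_le_const (half_pos hε)).exists
  refine ⟨m, fun b k => (β.cellDensity m b k + δ) / (1 + N * δ),
    fun b k => div_pos (hpos m b k) hZ, fun b => ?_, ?_⟩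
  · rw [← Finset.sum_div, div_le_one hZ, Finset.sum_add_distrib, Finset.sum_const,
      Finset.card_univ, Fintype.card_fin, nsmul_eq_mul]
    gcongr
    exact β.sum_cellDensity_le_one hf m b
  · have hle : ∀ x, -Real.log ((β.cellDensity m (gridCell m (f x)) (β.branch x) + δ) /
        (1 + N * δ)) ≤ Real.log (β.slope x) + (e m x + ε / 2) := by
      intro x
      rw [Real.log_div (hpos _ _ _).ne' hZ.ne']
      have h1 := Real.log_le_sub_one_of_pos hZ
      have h2 : -Real.log (β.cellDensity m (gridCell m (f x)) (β.branch x) + δ) -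
        Real.log (β.slope x) ≤ e m x := le_max_left _ _
      linarith
    calc _ ≤ ∫ x, (Real.log (β.slope x) + (e m x + ε / 2)) :=
          integral_mono (hint m fun b k => -Real.log ((β.cellDensity m b k + δ) / (1 + N * δ)))
            (β.integrable_log_slope.add ((hei m).add (integrable_const _))) hle
      _ = (∫ x, Real.log (β.slope x)) + ((∫ x, e m x) + ε / 2) := by
          have h1 : Integrable fun x => e m x + ε / 2 := (hei m).add (integrable_const _)
          rw [integral_add β.integrable_log_slope h1, integral_add (hei m) (integrable_const _)]
          simp
      _ ≤ _ := by linarith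

/-- The grid is fixed, depending on `ε`, before `n → ∞`; both errors are then constant multiples of
`log (n + 1) / n`. -/
theorem tendsto_samplingEntropy_div (hf : MeasurePreserving f volume volume) :
    Tendsto (fun n : ℕ => (Permuton.ofMap f hf).samplingEntropy n / n) atTop
      (𝓝 (∫ x, Real.log (β.slope x))) := by
  have hlog : ∀ c a : ℝ, Tendsto (fun n : ℕ => a + c * (Real.log (n + 1) / n)) atTop (𝓝 a) :=
    fun c a => by simpa using (tendsto_log_succ_div_atTop.const_mul c).const_add a
  refine tendsto_order.2 ⟨fun a ha => ?_, fun a ha => ?_⟩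
  · filter_upwards [(hlog (-N) _).eventually_const_lt ha, eventually_gt_atTop 0] with n hn hn0
    have hn0' : (0 : ℝ) < n := Nat.cast_pos.2 hn0
    refine hn.trans_le ?_
    rw [le_div_iff₀ hn0']
    refine le_trans (le_of_eq ?_) (β.le_samplingEntropy hf n)
    field_simp
    ring
  · obtain ⟨ε, hεa, hε⟩ := exists_add_lt_and_pos_of_lt ha
    obtain ⟨m, r, hr, hsum, hle⟩ := β.exists_weights hf hε
    filter_upwards [(hlog ((m + 1 : ℕ) : ℝ) _).eventually_lt_const hεa, eventually_gt_atTop 0]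
      with n hn hn0
    have hn0' : (0 : ℝ) < n := Nat.cast_pos.2 hn0
    refine lt_of_le_of_lt ?_ hn
    rw [div_le_iff₀ hn0']
    refine (β.samplingEntropy_le hf (monotone_gridCell m) (monotone_gridCell m).measurable hr hsum
      n).trans ?_
    have h1 := mul_le_mul_of_nonneg_left hle hn0'.le
    refine (add_le_add_left h1 _).trans (le_of_eq ?_)
    field_simp

end ExpandingBranches

/-! ### Expansion, monotonicity and change of variables on C¹ pieces -/

section RealFunction

variable {f : unitInterval → unitInterval}

theorem toRealFun_coe (f : unitInterval → unitInterval) (x : unitInterval) :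
    toRealFun f x = f x :=
  IccExtend_val zero_le_one _ x

theorem toRealFun_mem_Icc (f : unitInterval → unitInterval) (x : ℝ) :
    toRealFun f x ∈ Icc (0 : ℝ) 1 :=
  (f (projIcc 0 1 zero_le_one x)).2

theorem measurable_toRealFun (hf : Measurable f) : Measurable (toRealFun f) :=
  measurable_subtype_coe.comp (hf.comp continuous_projIcc.measurable)

/-- A measure-preserving map does not send a set into a smaller set. -/
theorem volume_le_of_mapsTo_toRealFun (hf : MeasurePreserving f volume volume) {V B : Set ℝ}
    (hV : V ⊆ Icc 0 1) (hB : MeasurableSet B) (hVB : MapsTo (toRealFun f) V B) :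
    volume V ≤ volume B := by
  have hB' : MeasurableSet ((↑) ⁻¹' B : Set unitInterval) := measurable_subtype_coe hB
  calc volume V ≤ volume ((↑) '' (f ⁻¹' ((↑) ⁻¹' B)) : Set ℝ) := by
        refine measure_mono fun x hx => ⟨⟨x, hV hx⟩, ?_, rfl⟩
        have := hVB hx
        rw [toRealFun, IccExtend_of_mem _ _ (hV hx)] at this
        exact this
    _ = volume ((↑) '' ((↑) ⁻¹' B : Set unitInterval) : Set ℝ) := by
        rw [← unitInterval.volume_apply, hf.measure_preimage hB'.nullMeasurableSet,
          unitInterval.volume_apply]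
    _ ≤ volume B := measure_mono (image_preimage_subset _ _)

variable {U : Set ℝ}

/-- Where it is continuously differentiable, a measure-preserving map is expanding. -/
theorem one_le_abs_deriv_toRealFun (hf : MeasurePreserving f volume volume) (hU : IsOpen U)
    (hU01 : U ⊆ Icc 0 1) (hC1 : ContDiffOn ℝ 1 (toRealFun f) U) {x : ℝ} (hx : x ∈ U) :
    1 ≤ |deriv (toRealFun f) x| := by
  by_contra! hlt
  obtain ⟨c, hc, hc1⟩ := exists_between hlt
  have hc0 : 0 < c := (abs_nonneg _).trans_lt hc
  have hcont : ContinuousAt (fun y => |deriv (toRealFun f) y|) x :=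
    ((hC1.continuousOn_deriv_of_isOpen hU le_rfl).continuousAt (hU.mem_nhds hx)).abs
  obtain ⟨η, hη, hball⟩ := Metric.nhds_basis_closedBall.mem_iff.1
    (inter_mem (hU.mem_nhds hx) (hcont.eventually_lt_const hc))
  -- With slope below `c < 1`, a ball of radius `η` would be mapped into one of radius `c * η`,
  -- which has smaller measure.
  have hmaps : MapsTo (toRealFun f) (Metric.closedBall x η)
      (Metric.closedBall (toRealFun f x) (c * η)) := by
    intro y hy
    have hd : ∀ z ∈ Metric.closedBall x η, DifferentiableAt ℝ (toRealFun f) z := fun z hz =>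
      (hC1.differentiableOn one_ne_zero).differentiableAt (hU.mem_nhds (hball hz).1)
    have h := (convex_closedBall x η).norm_image_sub_le_of_norm_deriv_le hd
      (fun z hz => (hball hz).2.le) (Metric.mem_closedBall_self hη.le) hy
    rw [Metric.mem_closedBall, dist_eq_norm]
    exact h.trans (mul_le_mul_of_nonneg_left (by rwa [← dist_eq_norm]) hc0.le)
  have hvol := volume_le_of_mapsTo_toRealFun hf (fun y hy => hU01 (hball hy).1)
    Metric.isClosed_closedBall.measurableSet hmaps
  rw [Real.volume_closedBall, Real.volume_closedBall,
    ENNReal.ofReal_le_ofReal_iff (by positivity)] at hvol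
  nlinarith

/-- The derivative never vanishes, so by Darboux's theorem it has constant sign on the interval. -/
theorem strictMonoOn_or_strictAntiOn_toRealFun (hf : MeasurePreserving f volume volume)
    {a b : ℝ} (hU01 : Ioo a b ⊆ Icc 0 1) (hC1 : ContDiffOn ℝ 1 (toRealFun f) (Ioo a b)) :
    StrictMonoOn (toRealFun f) (Ioo a b) ∨ StrictAntiOn (toRealFun f) (Ioo a b) := by
  have hd : ∀ x ∈ Ioo a b, HasDerivWithinAt (toRealFun f) (deriv (toRealFun f) x) (Ioo a b) x :=
    fun x hx => ((hC1.differentiableOn one_ne_zero).differentiableAt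
      (isOpen_Ioo.mem_nhds hx)).hasDerivAt.hasDerivWithinAt
  have hne : ∀ x ∈ Ioo a b, deriv (toRealFun f) x ≠ 0 := fun x hx h => by
    have := one_le_abs_deriv_toRealFun hf isOpen_Ioo hU01 hC1 hx
    norm_num [h] at this
  rcases hasDerivWithinAt_forall_lt_or_forall_gt_of_forall_ne (convex_Ioo a b) hd hne with h | h
  · exact Or.inr (strictAntiOn_of_deriv_neg (convex_Ioo a b) hC1.continuousOn
      (by simpa only [interior_Ioo] using h))
  · exact Or.inl (strictMonoOn_of_deriv_pos (convex_Ioo a b) hC1.continuousOn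
      (by simpa only [interior_Ioo] using h))

theorem setLIntegral_abs_deriv_eq_volume_image {F : ℝ → ℝ} (hU : IsOpen U)
    (hC1 : ContDiffOn ℝ 1 F U) (hinj : InjOn F U) {s : Set ℝ} (hs : MeasurableSet s)
    (hsU : s ⊆ U) : ∫⁻ x in s, ENNReal.ofReal |deriv F x| = volume (F '' s) := by
  have h := lintegral_image_eq_lintegral_abs_deriv_mul hs (fun x hx =>
    ((hC1.differentiableOn one_ne_zero).differentiableAt
      (hU.mem_nhds (hsU hx))).hasDerivAt.hasDerivWithinAt) (hinj.mono hsU) 1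
  simpa using h.symm

theorem unitInterval.setLIntegral_coe {h : ℝ → ENNReal} (s : Set unitInterval) :
    ∫⁻ x in s, h x = ∫⁻ x in (↑) '' s, h x := by
  rw [unitInterval.measurePreserving_coe.setLIntegral_comp_emb
    unitInterval.measurableEmbedding_coe, Measure.restrict_restrict_of_subset]
  rintro _ ⟨x, -, rfl⟩
  exact x.2

end RealFunction

/-- The cell contains an interval to the right of `y`. The case `y = 1` is excluded because its cell
is the null set `{1}`. -/
theorem volume_gridCell_pos {m : ℕ} (hm : 0 < m) {y : unitInterval} (hy : (y : ℝ) < 1) :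
    0 < volume (gridCell m ⁻¹' {gridCell m y}) := by
  have hm' : (0 : ℝ) < m := Nat.cast_pos.2 hm
  set z : ℝ := min 1 ((⌊(m : ℝ) * y⌋₊ + 1) / m) with hz
  have hyz : (y : ℝ) < z := lt_min hy (by
    rw [lt_div_iff₀ hm', mul_comm]
    exact Nat.lt_floor_add_one _)
  rw [unitInterval.volume_apply]
  refine lt_of_lt_of_le ?_ (measure_mono (s := Ico (y : ℝ) z) fun t ht => ?_)
  · rw [Real.volume_Ico]
    exact ENNReal.ofReal_pos.2 (sub_pos.2 hyz)
  · refine ⟨⟨t, y.2.1.trans ht.1, (ht.2.trans_le (min_le_left _ _)).le⟩, ?_, rfl⟩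
    have ht' : t < (⌊(m : ℝ) * y⌋₊ + 1) / m := ht.2.trans_le (min_le_right _ _)
    rw [lt_div_iff₀ hm', mul_comm] at ht'
    simp only [mem_preimage, mem_singleton_iff, gridCell, Fin.mk.injEq]
    rw [Nat.floor_eq_iff (mul_nonneg hm'.le (y.2.1.trans ht.1))]
    exact ⟨(Nat.floor_le (mul_nonneg hm'.le y.2.1)).trans
      (mul_le_mul_of_nonneg_left ht.1 hm'.le), ht'⟩

theorem mul_dist_lt_one_of_gridCell_eq {m : ℕ} {y z : unitInterval}
    (h : gridCell m y = gridCell m z) : m * dist (y : ℝ) z < 1 := by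
  have h' : ⌊(m : ℝ) * y⌋₊ = ⌊(m : ℝ) * z⌋₊ := congrArg Fin.val h
  have hy := Nat.floor_le (mul_nonneg m.cast_nonneg y.2.1)
  have hy' := Nat.lt_floor_add_one ((m : ℝ) * y)
  have hz := Nat.floor_le (mul_nonneg m.cast_nonneg z.2.1)
  have hz' := Nat.lt_floor_add_one ((m : ℝ) * z)
  rw [h'] at hy hy'
  have habs : m * dist (y : ℝ) z = |(m : ℝ) * y - m * z| := by
    rw [Real.dist_eq, ← mul_sub, abs_mul, Nat.abs_cast]
  rw [habs, abs_lt]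
  constructor <;> linarith

/-! ### Intervals of the partition -/

section Partition

variable {N : ℕ} {a : Fin (N + 1) → ℝ}

theorem lt_of_mem_Ioo_partition (ha : StrictMono a) {k l : Fin N} (hkl : k < l) {x y : ℝ}
    (hx : x ∈ Ioo (a k.castSucc) (a k.succ)) (hy : y ∈ Ioo (a l.castSucc) (a l.succ)) : x < y :=
  (hx.2.trans_le (ha.monotone (Fin.succ_le_castSucc_iff.2 hkl))).trans hy.1

theorem eq_of_mem_Ioo_partition (ha : StrictMono a) {k l : Fin N} {x : ℝ}
    (hk : x ∈ Ioo (a k.castSucc) (a k.succ)) (hl : x ∈ Ioo (a l.castSucc) (a l.succ)) : k = l := by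
  rcases lt_trichotomy k l with h | h | h
  · exact absurd (lt_of_mem_Ioo_partition ha h hk hl) (lt_irrefl x)
  · exact h
  · exact absurd (lt_of_mem_Ioo_partition ha h hl hk) (lt_irrefl x)

theorem ne_of_mem_Ioo_partition (ha : StrictMono a) {k : Fin N} {x : ℝ}
    (hk : x ∈ Ioo (a k.castSucc) (a k.succ)) (i : Fin (N + 1)) : x ≠ a i := by
  rcases le_or_gt i k.castSucc with h | h
  · exact ((ha.monotone h).trans_lt hk.1).ne'
  · exact (hk.2.trans_le (ha.monotone (Fin.castSucc_lt_iff_succ_le.1 h))).ne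

theorem exists_mem_Ioo_partition (h0 : a 0 = 0) (h1 : a (Fin.last N) = 1)
    {x : ℝ} (hx : x ∈ Icc (0 : ℝ) 1) (hne : ∀ i, x ≠ a i) :
    ∃ k : Fin N, x ∈ Ioo (a k.castSucc) (a k.succ) := by
  classical
  set s := Finset.univ.filter fun i => a i < x
  have hs : s.Nonempty := ⟨0, by simpa [s, h0] using lt_of_le_of_ne hx.1 (h0 ▸ (hne 0).symm)⟩
  have hmem : a (s.max' hs) < x := by simpa [s] using s.max'_mem hs
  rcases Fin.eq_castSucc_or_eq_last (s.max' hs) with ⟨k, hk⟩ | hk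
  · refine ⟨k, hk ▸ hmem, ?_⟩
    by_contra hcon
    have : k.succ ∈ s := by simpa [s] using lt_of_le_of_ne (not_lt.1 hcon) (hne _).symm
    exact absurd (hk ▸ s.le_max' _ this) (not_le.2 k.castSucc_lt_succ)
  · rw [hk, h1] at hmem
    exact absurd hx.2 (not_le.2 hmem)

theorem Ioo_partition_subset_Icc (ha : StrictMono a) (h0 : a 0 = 0) (h1 : a (Fin.last N) = 1)
    (k : Fin N) : Ioo (a k.castSucc) (a k.succ) ⊆ Icc 0 1 :=
  Ioo_subset_Icc_self.trans (Icc_subset_Icc (h0 ▸ ha.monotone (Fin.zero_le _))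
    (h1 ▸ ha.monotone (Fin.le_last _)))

end Partition

/-! ### Construction of the branches and conclusion -/

/-- A set of heights in the image of `V` is at most `c` times larger than its preimage in `V`, if
the slope on `V` is at most `c`. -/
theorem volume_le_mul_volume_of_subset_image {f : unitInterval → unitInterval}
    (hf : Measurable f) {U V : Set ℝ} (hU : IsOpen U)
    (hC1 : ContDiffOn ℝ 1 (toRealFun f) U) (hinj : InjOn (toRealFun f) U) (hV : MeasurableSet V)
    (hVU : V ⊆ U) {c : ℝ} (hVc : ∀ x ∈ V, |deriv (toRealFun f) x| ≤ c)
    {T : Set unitInterval} (hT : MeasurableSet T)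
    (hTV : (↑) '' T ⊆ toRealFun f '' V) :
    volume T ≤ ENNReal.ofReal c * volume (V ∩ toRealFun f ⁻¹' ((↑) '' T)) := by
  set W := V ∩ toRealFun f ⁻¹' ((↑) '' T) with hW
  have hWm : MeasurableSet W := hV.inter (measurable_toRealFun hf
    (unitInterval.measurableEmbedding_coe.measurableSet_image.2 hT))
  calc volume T = volume ((↑) '' T : Set ℝ) := unitInterval.volume_apply
    _ ≤ volume (toRealFun f '' W) := measure_mono fun y hy => by
        obtain ⟨x, hx, rfl⟩ := hTV hy
        exact ⟨x, ⟨hx, hy⟩, rfl⟩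
    _ = ∫⁻ x in W, ENNReal.ofReal |deriv (toRealFun f) x| :=
        (setLIntegral_abs_deriv_eq_volume_image hU hC1 hinj hWm (fun x hx => hVU hx.1)).symm
    _ ≤ ∫⁻ _ in W, ENNReal.ofReal c := setLIntegral_mono measurable_const fun x hx =>
        ENNReal.ofReal_le_ofReal (hVc x hx.1)
    _ = ENNReal.ofReal c * volume W := by rw [setLIntegral_const]

theorem exists_expandingBranches {f : unitInterval → unitInterval}
    (hf : MeasurePreserving f volume volume) (hpw : IsPiecewiseC1 f) :
    ∃ (N : ℕ) (β : ExpandingBranches f N), ∀ᵐ x, β.slope x = |deriv (toRealFun f) x| := by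
  classical
  obtain ⟨N, a, ha, h0, h1, hC1⟩ := hpw
  let F := toRealFun f
  let U : Fin N → Set ℝ := fun k => Ioo (a k.castSucc) (a k.succ)
  have hU01 : ∀ k, U k ⊆ Icc 0 1 := Ioo_partition_subset_Icc ha h0 h1
  have hmono : ∀ k, StrictMonoOn F (U k) ∨ StrictAntiOn F (U k) := fun k =>
    strictMonoOn_or_strictAntiOn_toRealFun hf (hU01 k) (hC1 k)
  have hinj : ∀ k, InjOn F (U k) := fun k => (hmono k).elim (·.injOn) (·.injOn)
  let good : Set unitInterval := {x | ∀ i, (x : ℝ) ≠ a i}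
  have hfin : goodᶜ.Finite := by
    refine ((finite_range a).preimage Subtype.val_injective.injOn).subset fun x hx => ?_
    obtain ⟨i, hi⟩ := not_forall.1 hx
    exact ⟨i, (not_not.1 hi).symm⟩
  have hgood_ae : ∀ᵐ x, x ∈ good := mem_ae_iff.2 (hfin.measure_zero volume)
  have hgood : MeasurableSet good := MeasurableSet.of_compl hfin.measurableSet
  have hN : Nonempty (Fin N) := by
    rcases N with _ | N
    · exact absurd (h0.symm.trans h1) zero_ne_one
    · exact ⟨0⟩
  have hex : ∀ x : unitInterval, ∃ k, x ∈ good → (x : ℝ) ∈ U k := fun x => by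
    by_cases hx : x ∈ good
    · obtain ⟨k, hk⟩ := exists_mem_Ioo_partition h0 h1 x.2 hx
      exact ⟨k, fun _ => hk⟩
    -- Partition points receive an arbitrary branch; they form a finite, hence null, set.
    · exact ⟨hN.some, fun h => absurd h hx⟩
  choose branch hbranch using hex
  have hgood_of_mem : ∀ {x : unitInterval} {k}, (x : ℝ) ∈ U k → x ∈ good := fun hx =>
    ne_of_mem_Ioo_partition ha hx
  have hbranch_eq : ∀ {x : unitInterval} {k}, (x : ℝ) ∈ U k → branch x = k := fun hx =>
    eq_of_mem_Ioo_partition ha (hbranch _ (hgood_of_mem hx)) hx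
  have hbranch_meas : Measurable branch := by
    refine measurable_to_countable' fun k => ?_
    have : branch ⁻¹' {k} = (↑) ⁻¹' U k ∪ (branch ⁻¹' {k} ∩ goodᶜ) := by
      ext x
      constructor
      · intro hx
        by_cases hxg : x ∈ good
        · exact Or.inl (mem_singleton_iff.1 hx ▸ hbranch x hxg)
        · exact Or.inr ⟨hx, hxg⟩
      · rintro (hx | hx)
        · exact hbranch_eq hx
        · exact hx.1
    rw [this]
    exact (measurable_subtype_coe measurableSet_Ioo).union
      (hfin.subset inter_subset_right).measurableSet
  have hslope : ∀ x ∈ good, max 1 |deriv F x| = |deriv F x| := fun x hx =>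
    max_eq_right (one_le_abs_deriv_toRealFun hf isOpen_Ioo (hU01 _) (hC1 _) (hbranch x hx))
  -- The `max` secures slope `≥ 1` at partition points too; on `good` it equals `|f'|` by `hslope`.
  refine ⟨N, ⟨branch, hbranch_meas, fun x => max 1 |deriv F x|, ?_, fun x => le_max_left _ _,
    fun k => StrictMonoOn F (U k), good, hgood_ae, ?_, ?_, ?_⟩, ?_⟩
  · exact measurable_const.max (measurable_norm.comp
      ((measurable_deriv F).comp measurable_subtype_coe))
  · intro x hx y hy
    rcases lt_trichotomy (branch x) (branch y) with h | h | h
    · have := lt_of_mem_Ioo_partition ha h (hbranch x hx) (hbranch y hy)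
      exact iff_of_true this (Or.inl h)
    · have hx' := hbranch x hx
      have hy' := hbranch y hy
      rw [← h] at hy'
      have key : x < y ↔ (StrictMonoOn F (U (branch x)) ∧ f x < f y ∨
          ¬ StrictMonoOn F (U (branch x)) ∧ f y < f x) := by
        rw [← Subtype.coe_lt_coe, ← Subtype.coe_lt_coe, ← Subtype.coe_lt_coe, ← toRealFun_coe,
          ← toRealFun_coe]
        by_cases hm : StrictMonoOn F (U (branch x))
        · simpa [hm] using (hm.lt_iff_lt hx' hy').symm
        · simpa [hm] using (((hmono _).resolve_left hm).lt_iff_gt hy' hx').symm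
      simpa [h.not_lt, h] using key
    · have := lt_of_mem_Ioo_partition ha h (hbranch y hy) (hbranch x hx)
      refine iff_of_false (not_lt.2 this.le) ?_
      rintro (h' | h')
      · exact lt_asymm h h'
      · exact h.ne' h'.1
  · intro k B hB
    set S := branch ⁻¹' {k} ∩ f ⁻¹' B with hS
    have hSm : MeasurableSet (S ∩ good) :=
      ((hbranch_meas (measurableSet_singleton k)).inter (hf.measurable hB)).inter hgood
    have hSU : ((↑) '' (S ∩ good) : Set ℝ) ⊆ U k := by
      rintro _ ⟨x, ⟨⟨hxk, -⟩, hxg⟩, rfl⟩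
      exact mem_singleton_iff.1 hxk ▸ hbranch x hxg
    have hae : (S ∩ good : Set unitInterval) =ᵐ[volume] S :=
      inter_ae_eq_left_of_ae_eq_univ (eventuallyEq_univ.2 hgood_ae)
    calc ∫⁻ x in S, ENNReal.ofReal (max 1 |deriv F x|)
        = ∫⁻ x in S ∩ good, ENNReal.ofReal |deriv F x| := by
          rw [← setLIntegral_congr hae]
          exact setLIntegral_congr_fun hSm fun x hx => by
            simp only [hslope x hx.2]
      _ = volume (F '' ((↑) '' (S ∩ good))) := by
          rw [unitInterval.setLIntegral_coe (h := fun x => ENNReal.ofReal |deriv F x|),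
            setLIntegral_abs_deriv_eq_volume_image isOpen_Ioo (hC1 k) (hinj k)
              (unitInterval.measurableEmbedding_coe.measurableSet_image.2 hSm) hSU]
      _ ≤ volume ((↑) '' B : Set ℝ) := by
          refine measure_mono ?_
          rintro _ ⟨_, ⟨x, hx, rfl⟩, rfl⟩
          exact ⟨f x, hx.1.2, (toRealFun_coe f x).symm⟩
      _ = volume B := unitInterval.volume_apply.symm
  · filter_upwards [hgood_ae] with x hx ε hε
    set k := branch x with hk
    have hxU : (x : ℝ) ∈ U k := hbranch x hx
    have hUx : U k ∈ 𝓝 (x : ℝ) := isOpen_Ioo.mem_nhds hxU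
    set s := max 1 |deriv F x| with hs
    have hs0 : 0 < s := zero_lt_one.trans_le (le_max_left _ _)
    have hcont : ContinuousOn (fun y => |deriv F y|) (U k) :=
      ((hC1 k).continuousOn_deriv_of_isOpen isOpen_Ioo le_rfl).abs
    -- Points of the branch with slope below `s + ε`. As `f' x ≠ 0`, the image of `V` is a
    -- neighbourhood of `f x` and swallows its cell once the mesh is small.
    set V := U k ∩ (fun y => |deriv F y|) ⁻¹' Iio (s + ε) with hV
    have hVopen : IsOpen V := hcont.isOpen_inter_preimage isOpen_Ioo isOpen_Iio
    have hxV : (x : ℝ) ∈ V :=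
      ⟨hxU, (le_max_right 1 |deriv F x|).trans_lt (lt_add_of_pos_right _ hε)⟩
    have hstrict : HasStrictDerivAt F (deriv F x) x :=
      ((hC1 k).contDiffAt hUx).hasStrictDerivAt one_ne_zero
    have hne : deriv F x ≠ 0 := fun h => by
      have := hslope x hx
      rw [h, abs_zero] at this
      norm_num at this
    have himage : F '' V ∈ 𝓝 (F x) := by
      rw [← hstrict.map_nhds_eq hne]
      exact image_mem_map (hVopen.mem_nhds hxV)
    -- A neighbourhood of `f x` lies in `[0,1]`, so `f x` is interior and its cell is not the null
    -- one.
    have hfx : (f x : ℝ) < 1 := by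
      have h01 : Icc (0 : ℝ) 1 ∈ 𝓝 (F x) := mem_of_superset himage (by
        rintro _ ⟨y, -, rfl⟩
        exact toRealFun_mem_Icc f y)
      have := mem_interior_iff_mem_nhds.2 h01
      rw [interior_Icc] at this
      exact toRealFun_coe f x ▸ this.2
    obtain ⟨ρ, hρ, hball⟩ := Metric.mem_nhds_iff.1 himage
    obtain ⟨m₀, hm₀⟩ := exists_nat_gt ρ⁻¹
    filter_upwards [eventually_ge_atTop m₀] with m hm
    have hmρ : ρ⁻¹ < m := hm₀.trans_le (Nat.cast_le.2 hm)
    have hm0 : (0 : ℝ) < m := (inv_pos.2 hρ).trans hmρ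
    set T := gridCell m ⁻¹' {gridCell m (f x)} with hT
    have hTm : MeasurableSet T :=
      (monotone_gridCell m).measurable (measurableSet_singleton _)
    have hTV : (↑) '' T ⊆ F '' V := by
      rintro _ ⟨y, hy, rfl⟩
      refine hball (Metric.mem_ball.2 ?_)
      have h := mul_dist_lt_one_of_gridCell_eq (mem_singleton_iff.1 hy)
      rw [← toRealFun_coe f x] at h
      have h' : ρ⁻¹ * dist (y : ℝ) (F x) < 1 :=
        (mul_le_mul_of_nonneg_right hmρ.le dist_nonneg).trans_lt h
      rwa [inv_mul_lt_one₀ hρ] at h'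
    have hle := volume_le_mul_volume_of_subset_image hf.measurable isOpen_Ioo (hC1 k) (hinj k)
      hVopen.measurableSet inter_subset_left (fun y hy => (mem_Iio.1 hy.2).le) hTm hTV
    have hsub : volume (V ∩ F ⁻¹' ((↑) '' T)) ≤ volume (branch ⁻¹' {k} ∩ f ⁻¹' T) := by
      rw [unitInterval.volume_apply (s := branch ⁻¹' {k} ∩ f ⁻¹' T)]
      refine measure_mono ?_
      rintro y ⟨hyV, z, hz, hzy⟩
      refine ⟨⟨y, hU01 k hyV.1⟩, ⟨hbranch_eq (k := k) hyV.1, ?_⟩, rfl⟩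
      have : z = f ⟨y, hU01 k hyV.1⟩ := Subtype.ext (hzy.trans (toRealFun_coe f ⟨y, hU01 k hyV.1⟩))
      rw [mem_preimage, ← this]
      exact hz
    have hpos : 0 < (volume : Measure unitInterval).real T :=
      ENNReal.toReal_pos (volume_gridCell_pos (Nat.cast_pos.1 hm0) hfx).ne' (measure_ne_top _ _)
    have hreal : (volume : Measure unitInterval).real T ≤
        (s + ε) * (volume : Measure unitInterval).real (branch ⁻¹' {k} ∩ f ⁻¹' T) := by
      have h := ENNReal.toReal_mono (ENNReal.mul_ne_top ENNReal.ofReal_ne_top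
        (measure_ne_top volume _)) (hle.trans (mul_le_mul_right hsub _))
      rwa [ENNReal.toReal_mul, ENNReal.toReal_ofReal (by positivity)] at h
    rw [le_div_iff₀ hpos, inv_mul_le_iff₀ (by positivity)]
    exact hreal
  · filter_upwards [hgood_ae] with x hx using hslope x hx

theorem theorem2 (f : unitInterval → unitInterval) (hf : MeasurePreserving f volume volume) (hpw : IsPiecewiseC1 f) :
    IntervalIntegrable (fun x => Real.log |deriv (toRealFun f) x|) volume 0 1 ∧
    Tendsto (fun n : ℕ => (Permuton.ofMap f hf).samplingEntropy n / (n : ℝ)) atTop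
      (𝓝 (∫ x in (0 : ℝ)..1, Real.log |deriv (toRealFun f) x|)) := by
  obtain ⟨N, β, hβ⟩ := exists_expandingBranches hf hpw
  have hae : (fun x => Real.log (β.slope x)) =ᵐ[volume]
      fun x : unitInterval => Real.log |deriv (toRealFun f) x| := by
    filter_upwards [hβ] with x hx
    rw [hx]
  constructor
  · rw [intervalIntegrable_iff_integrableOn_Icc_of_le zero_le_one]
    exact (unitInterval.measurePreserving_coe.integrable_comp_emb
      unitInterval.measurableEmbedding_coe).1 (β.integrable_log_slope.congr hae)
  · have h := β.tendsto_samplingEntropy_div hf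
    rw [integral_congr_ae hae] at h
    rw [intervalIntegral.integral_of_le zero_le_one, ← integral_Icc_eq_integral_Ioc,
      ← unitInterval.measurePreserving_coe.integral_comp unitInterval.measurableEmbedding_coe]
    exact h
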